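/- Let $X, X_1,X_2,\dots$ be independent identically distributed real random variables with an arbitrary distribution, and let $f(v)=\mathbb{E}e^{ivX}$, $v\in\mathbb{R}$, be their characteristic function. Put $S_0=0$, $S_n=X_1+\dots+X_n$ and $M_n=\max_{0\le k\le n}S_k$. Let $\ln$ and $\sqrt{\cdot}$ denote the principal branches, and for $g:\mathbb{R}\setminus\{0\}\to\mathbb{C}$ let $\int_{-\infty}^{\infty}g(u)\,du$ denote the principal value $\lim_{\varepsilon\downarrow0,\,A\uparrow\infty}\big(\int_{\varepsilon}^{A}+\int_{-A}^{-\varepsilon}\big)g(u)\,du$. Then for all real $s,t$ and all complex $z$ with $|z|<1$ the series and the principal-value integrals below converge, and $$\sum_{n=0}^\infty \mathbb{E}\exp\{i[sM_n+t(M_n-S_n)]\}\,z^n=\frac{1}{\sqrt{(1-zf(s))(1-zf(-t))}}\,\exp\Big\{\frac{1}{4\pi i}\int_{-\infty}^{\infty}\frac{du}{u}\Big(\ln\frac{1-zf(s-u)}{1-zf(s+u)}+\ln\frac{1-zf(-t+u)}{1-zf(-t-u)}\Big)\Big\}.$$ In particular (the case $t=0$), $$\sum_{n=0}^\infty \mathbb{E}e^{isM_n}\,z^n=\frac{1}{\sqrt{(1-zf(s))(1-z)}}\,\exp\Big\{\frac{1}{4\pi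 i}\int_{-\infty}^{\infty}\frac{du}{u}\Big(\ln\frac{1-zf(s-u)}{1-zf(s+u)}+\ln\frac{1-zf(u)}{1-zf(-u)}\Big)\Big\}.$$ -/

import Mathlib

open MeasureTheory ProbabilityTheory Filter Topology

noncomputable section

namespace SpitzerIdentity

/-- The partial sum `S_n = X_1 + ... + X_n`, with `S_0 = 0`. The steps are indexed from `0`,
so that `X j` is the `(j + 1)`-st step. -/
def walkSum {Ω : Type*} (X : ℕ → Ω → ℝ) (n : ℕ) (ω : Ω) : ℝ :=
  ∑ j ∈ Finset.range n, X j ω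

/-- The maximum `M_n = max (S_0, S_1, ..., S_n)`. -/
def walkMax {Ω : Type*} (X : ℕ → Ω → ℝ) (n : ℕ) (ω : Ω) : ℝ :=
  (Finset.range (n + 1)).sup' Finset.nonempty_range_add_one (fun k => walkSum X k ω)

/-- `φ_n(s, t) = E exp (i (s M_n + t (M_n - S_n)))`. -/
def jointCF {Ω : Type*} [MeasurableSpace Ω] (P : Measure Ω) (X : ℕ → Ω → ℝ) (n : ℕ)
    (s t : ℝ) : ℂ :=
  ∫ ω, Complex.exp
    (Complex.I * ((s * walkMax X n ω + t * (walkMax X n ω - walkSum X n ω) : ℝ) : ℂ)) ∂P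

/-- The integral of `g` over the real line, in the principal-value sense at `0` and at infinity,
exists and equals `L`: `g` is integrable on `[ε, A]` and on `[-A, -ε]` whenever `0 < ε ≤ A`, and
the sum of the two integrals tends to `L` as `ε ↓ 0` and `A ↑ ∞` (jointly and independently). -/
def HasPVIntegral (g : ℝ → ℂ) (L : ℂ) : Prop :=
  (∀ ε A : ℝ, 0 < ε → ε ≤ A →
    IntervalIntegrable g volume ε A ∧ IntervalIntegrable g volume (-A) (-ε)) ∧
  Tendsto (fun p : ℝ × ℝ => (∫ u in p.1..p.2, g u) + ∫ u in (-p.2)..(-p.1), g u)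
    (𝓝[>] (0 : ℝ) ×ˢ atTop) (𝓝 L)

end SpitzerIdentity

end

/-! Cut a path at the first time its maximum is attained. Up to that time it ends in a strict
record; afterwards its increments sum to nonpositive values. By independence the generating function
is a product A(s) B(-t), where the coefficients of A - 1 are transforms of measures on (0, ∞), those
of B - 1 transforms of measures on (-∞, 0], and t = -s gives A B = 1 / (1 - z f). Such a Wiener-Hopf
factorization is unique: A'/A + B'/B = Σ f^(n+1) z^n, and the two summands have as coefficients
transforms of signed measures on disjoint half-lines, so they come from restricting the law of
S_(n+1) to these half-lines (`derivative_eq_of_mul_eq_geometric`, `jointCF_recurrence`). Integrating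
in z (`hasSum_exp_of_recurrence`) gives Spitzer's formula exp Σ (z^n / n) c_n with c_n =
E[e^{isS_n}; S_n > 0] + E[e^{-itS_n}; S_n ≤ 0].

For the integral form, write the half-line indicators as (1 ± sgn) / 2. The constant halves sum to
logarithms of 1 - z f, which produce the square root. For the sign halves, the Dirichlet integral
∫₀^∞ sin(uy)/u du = (π/2) sgn y turns E[e^{isS_n} sgn S_n] into a principal value of (f(s+u)^n -
f(s-u)^n) / u, and summation over n gives the logarithm of a quotient (`hasPVIntegral_log_div`). The
boundedness of the sine integral and |z| < 1 justify the exchanges of limits. -/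

noncomputable section

namespace SpitzerIdentity

/-! ### The sine integral and the Dirichlet integral -/

/-- The sine integral `∫₀ˣ sin u / u du`. -/
def sineIntegral (x : ℝ) : ℝ := ∫ u in (0 : ℝ)..x, Real.sinc u

lemma intervalIntegrable_sinc (a b : ℝ) : IntervalIntegrable Real.sinc volume a b :=
  Real.continuous_sinc.intervalIntegrable a b

lemma continuous_sineIntegral : Continuous sineIntegral :=
  intervalIntegral.continuous_primitive intervalIntegrable_sinc 0

@[simp] lemma sineIntegral_zero : sineIntegral 0 = 0 := by simp [sineIntegral]

lemma sineIntegral_neg (x : ℝ) : sineIntegral (-x) = -sineIntegral x := by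
  have h := intervalIntegral.integral_comp_neg (f := Real.sinc) (a := 0) (b := x)
  simp only [Real.sinc_neg, neg_zero] at h
  rw [sineIntegral, sineIntegral, h, intervalIntegral.integral_symm]

lemma integral_sin_mul_exp (A y : ℝ) :
    ∫ x in (0 : ℝ)..A, Real.sin x * Real.exp (-(x * y)) =
      (1 - Real.exp (-(A * y)) * (Real.cos A + y * Real.sin A)) / (1 + y ^ 2) := by
  have hy : 1 + y ^ 2 ≠ 0 := by positivity
  have hd : ∀ x ∈ Set.uIcc 0 A, HasDerivAt
      (fun x => -(Real.exp (-(x * y)) * (Real.cos x + y * Real.sin x)) / (1 + y ^ 2))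
      (Real.sin x * Real.exp (-(x * y))) x := by
    intro x _
    have h1 : HasDerivAt (fun x => Real.exp (-(x * y))) (Real.exp (-(x * y)) * (-(1 * y))) x :=
      (((hasDerivAt_id x).mul_const y).neg).exp
    have h2 := (Real.hasDerivAt_cos x).add ((Real.hasDerivAt_sin x).const_mul y)
    refine (((h1.mul h2).neg).div_const (1 + y ^ 2)).congr_deriv ?_
    rw [div_eq_iff hy, Pi.add_apply]
    ring
  rw [intervalIntegral.integral_eq_sub_of_hasDerivAt hd
    (Continuous.intervalIntegrable (by fun_prop) _ _)]
  simp
  field_simp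
  ring

lemma integral_exp_neg_mul_Ioi {x : ℝ} (hx : 0 < x) :
    ∫ y in Set.Ioi (0 : ℝ), Real.exp (-(x * y)) = x⁻¹ := by
  have := integral_exp_mul_Ioi (a := -x) (by linarith) 0
  simpa [neg_div] using this

lemma integrableOn_exp_neg_mul_Ioi {x : ℝ} (hx : 0 < x) :
    IntegrableOn (fun y => Real.exp (-(x * y))) (Set.Ioi 0) := by
  simpa using integrableOn_exp_mul_Ioi (a := -x) (by linarith) 0

/-- Insert 1/x = ∫₀^∞ e^{-xy} dy and apply Fubini. Absolute integrability holds on a bounded x-range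
because integrating the modulus over y leaves |sinc x|. -/
lemma sineIntegral_eq_integral_Ioi {A : ℝ} (hA : 0 < A) :
    sineIntegral A = ∫ y in Set.Ioi (0 : ℝ),
      (1 - Real.exp (-(A * y)) * (Real.cos A + y * Real.sin A)) / (1 + y ^ 2) := by
  have hint : Integrable (Function.uncurry fun x y : ℝ => Real.sin x * Real.exp (-(x * y)))
      ((volume.restrict (Set.Ioc 0 A)).prod (volume.restrict (Set.Ioi 0))) := by
    rw [integrable_prod_iff (by
      refine Continuous.aestronglyMeasurable ?_
      unfold Function.uncurry
      fun_prop)]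
    constructor
    · filter_upwards [ae_restrict_mem measurableSet_Ioc] with x hx
      exact (integrableOn_exp_neg_mul_Ioi hx.1).const_mul (Real.sin x)
    · have : (fun x => ∫ y in Set.Ioi (0:ℝ), ‖Function.uncurry
          (fun x y : ℝ => Real.sin x * Real.exp (-(x * y))) (x, y)‖)
          =ᵐ[volume.restrict (Set.Ioc 0 A)] fun x => |Real.sinc x| := by
        filter_upwards [ae_restrict_mem measurableSet_Ioc] with x hx
        simp only [Function.uncurry, norm_mul, Real.norm_eq_abs, Real.abs_exp]
        rw [integral_const_mul, integral_exp_neg_mul_Ioi hx.1, Real.sinc_of_ne_zero hx.1.ne',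
          abs_div, abs_of_pos hx.1, div_eq_mul_inv]
      rw [integrable_congr this]
      exact (Real.continuous_sinc.abs.integrableOn_Icc).mono_set Set.Ioc_subset_Icc_self
  have hswap := integral_integral_swap hint
  have h1 : sineIntegral A = ∫ x in Set.Ioc 0 A, ∫ y in Set.Ioi (0 : ℝ),
      Real.sin x * Real.exp (-(x * y)) := by
    rw [sineIntegral, intervalIntegral.integral_of_le hA.le]
    refine setIntegral_congr_fun measurableSet_Ioc fun x hx => ?_
    rw [integral_const_mul, integral_exp_neg_mul_Ioi hx.1, Real.sinc_of_ne_zero hx.1.ne',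
      div_eq_mul_inv]
  rw [h1, hswap]
  refine integral_congr_ae (ae_of_all _ fun y => ?_)
  simp only
  rw [← intervalIntegral.integral_of_le hA.le, integral_sin_mul_exp]

/-- The term 1 / (1 + y²) of the Fubini formula integrates to π/2; the rest is dominated by 2
e^{-Ay}. -/
lemma abs_sineIntegral_sub_le {A : ℝ} (hA : 0 < A) : |sineIntegral A - Real.pi / 2| ≤ 2 / A := by
  have hbound : ∀ y ∈ Set.Ioi (0 : ℝ),
      ‖Real.exp (-(A * y)) * (Real.cos A + y * Real.sin A) / (1 + y ^ 2)‖
        ≤ 2 * Real.exp (-(A * y)) := by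
    intro y hy
    have hy0 : (0 : ℝ) < y := hy
    have hpos : (0 : ℝ) < 1 + y ^ 2 := by positivity
    rw [norm_div, norm_mul, Real.norm_eq_abs, Real.abs_exp, Real.norm_eq_abs, Real.norm_eq_abs,
      abs_of_pos hpos, div_le_iff₀ hpos]
    have h1 : |Real.cos A + y * Real.sin A| ≤ 1 + y := by
      refine (abs_add_le _ _).trans (add_le_add (Real.abs_cos_le_one A) ?_)
      rw [abs_mul, abs_of_pos hy0]
      exact mul_le_of_le_one_right hy0.le (Real.abs_sin_le_one A)
    have h2 : 1 + y ≤ 2 * (1 + y ^ 2) := by nlinarith [sq_nonneg (y - 1)]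
    nlinarith [Real.exp_pos (-(A * y))]
  have hi2 := (integrableOn_exp_neg_mul_Ioi hA).const_mul 2
  have hi : IntegrableOn
      (fun y => Real.exp (-(A * y)) * (Real.cos A + y * Real.sin A) / (1 + y ^ 2))
      (Set.Ioi 0) := by
    refine Integrable.mono' hi2 ?_ ?_
    · refine Continuous.aestronglyMeasurable ?_
      exact Continuous.div (by fun_prop) (by fun_prop) fun y => by positivity
    · filter_upwards [ae_restrict_mem measurableSet_Ioi] with y hy using hbound y hy
  have heq : sineIntegral A - Real.pi / 2 = - ∫ y in Set.Ioi (0 : ℝ),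
      Real.exp (-(A * y)) * (Real.cos A + y * Real.sin A) / (1 + y ^ 2) := by
    have h3 := integral_Ioi_inv_one_add_sq (i := 0)
    rw [Real.arctan_zero, sub_zero] at h3
    rw [sineIntegral_eq_integral_Ioi hA, ← h3, ← integral_sub, ← integral_neg]
    · refine integral_congr_ae (ae_of_all _ fun y => ?_)
      simp only
      ring
    · refine (integrable_inv_one_add_sq.integrableOn.sub hi).congr (ae_of_all _ fun y => ?_)
      simp only [Pi.sub_apply]
      ring
    · exact integrable_inv_one_add_sq.integrableOn
  rw [heq, abs_neg, ← Real.norm_eq_abs]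
  refine (norm_integral_le_of_norm_le hi2 ?_).trans_eq ?_
  · filter_upwards [ae_restrict_mem measurableSet_Ioi] with y hy using hbound y hy
  · rw [integral_const_mul, integral_exp_neg_mul_Ioi hA, div_eq_mul_inv]

/-- The Dirichlet integral. -/
lemma tendsto_sineIntegral_atTop : Tendsto sineIntegral atTop (𝓝 (Real.pi / 2)) := by
  rw [tendsto_iff_norm_sub_tendsto_zero]
  refine squeeze_zero' (Eventually.of_forall fun _ => norm_nonneg _) ?_
    ((tendsto_const_nhds (x := (2 : ℝ))).div_atTop tendsto_id)
  filter_upwards [eventually_gt_atTop 0] with A hA using abs_sineIntegral_sub_le hA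

/-- A crude uniform bound, serving as the dominating constant in every later limit: |sinc| ≤ 1
handles |x| ≤ 1, and π/2 + 2/x ≤ 4 the rest. -/
lemma abs_sineIntegral_le (x : ℝ) : |sineIntegral x| ≤ 4 := by
  have hpos : ∀ x : ℝ, 0 ≤ x → |sineIntegral x| ≤ 4 := by
    intro x hx
    rcases le_or_gt x 1 with h | h
    · have := intervalIntegral.norm_integral_le_of_norm_le_const (a := 0) (b := x)
        (f := Real.sinc) (C := 1) fun u _ => Real.abs_sinc_le_one u
      rw [sub_zero, one_mul, abs_of_nonneg hx] at this
      exact (this.trans h).trans (by norm_num)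
    · have h1 := abs_le.1 (abs_sineIntegral_sub_le (zero_lt_one.trans h))
      have h2 : 2 / x ≤ 2 := div_le_self (by norm_num) h.le
      have h3 := Real.pi_pos
      have h4 := Real.pi_le_four
      rw [abs_le]
      constructor <;> linarith [h1.1, h1.2]
  rcases le_total 0 x with h | h
  · exact hpos x h
  · have := hpos (-x) (by linarith)
    rwa [sineIntegral_neg, abs_neg] at this

/-- `∫_ε^A sin (u y) / u du`, written through `sinc`. -/
lemma integral_mul_sinc (ε A y : ℝ) :
    ∫ u in ε..A, y * Real.sinc (u * y) = sineIntegral (A * y) - sineIntegral (ε * y) := by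
  rw [intervalIntegral.integral_const_mul, intervalIntegral.mul_integral_comp_mul_right,
    sineIntegral, sineIntegral, intervalIntegral.integral_interval_sub_left
      (intervalIntegrable_sinc _ _) (intervalIntegrable_sinc _ _)]

lemma tendsto_sineIntegral_mul_sub (y : ℝ) :
    Tendsto (fun p : ℝ × ℝ => sineIntegral (p.2 * y) - sineIntegral (p.1 * y))
      (𝓝[>] (0 : ℝ) ×ˢ atTop) (𝓝 (Real.pi / 2 * SignType.sign y)) := by
  have h0 : Tendsto (fun p : ℝ × ℝ => sineIntegral (p.1 * y)) (𝓝[>] (0 : ℝ) ×ˢ atTop) (𝓝 0) := by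
    have : Tendsto (fun e : ℝ => sineIntegral (e * y)) (𝓝[>] (0 : ℝ)) (𝓝 0) := by
      have hc : Continuous fun e : ℝ => sineIntegral (e * y) :=
        continuous_sineIntegral.comp (by fun_prop)
      simpa using (hc.tendsto 0).mono_left nhdsWithin_le_nhds
    exact this.comp tendsto_fst
  have h1 : Tendsto (fun p : ℝ × ℝ => sineIntegral (p.2 * y)) (𝓝[>] (0 : ℝ) ×ˢ atTop)
      (𝓝 (Real.pi / 2 * SignType.sign y)) := by
    refine Tendsto.comp (g := fun A : ℝ => sineIntegral (A * y)) ?_ tendsto_snd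
    rcases lt_trichotomy y 0 with hy | rfl | hy
    · have := (tendsto_sineIntegral_atTop.comp
        (tendsto_id.atTop_mul_const (neg_pos.2 hy))).neg
      refine (this.congr fun A => ?_).trans_eq ?_
      · simp [sineIntegral_neg]
      · simp [sign_neg hy]
    · simp
    · simpa [sign_pos hy, Function.comp_def] using
        tendsto_sineIntegral_atTop.comp (tendsto_id.atTop_mul_const hy)
  simpa using h1.sub h0

/-! ### Sign transforms as limits of truncated integrals of characteristic functions -/

/-- `∫ e^{isy} sgn y dν(y)`. -/
def signCharFun (ν : Measure ℝ) (s : ℝ) : ℂ :=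
  ∫ y, Complex.exp (s * y * Complex.I) * ((SignType.sign y : ℝ) : ℂ) ∂ν

lemma norm_exp_mul_mul_I (s y : ℝ) : ‖Complex.exp (s * y * Complex.I)‖ = 1 := by
  rw [← Complex.ofReal_mul, Complex.norm_exp_ofReal_mul_I]

lemma abs_sign_le_one (y : ℝ) : |(SignType.sign y : ℝ)| ≤ 1 := by
  rcases lt_trichotomy y 0 with h | rfl | h
  · simp [sign_neg h]
  · simp
  · simp [sign_pos h]

lemma measurable_sign_real : Measurable fun y : ℝ => (SignType.sign y : ℝ) := by
  have : (fun y : ℝ => (SignType.sign y : ℝ)) =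
      (Set.Ioi (0 : ℝ)).indicator 1 - (Set.Iio (0 : ℝ)).indicator 1 := by
    ext y
    rcases lt_trichotomy y 0 with h | rfl | h
    · simp [sign_neg h, h, h.le]
    · simp
    · simp [sign_pos h, h, h.le]
  rw [this]
  exact (measurable_one.indicator measurableSet_Ioi).sub
    (measurable_one.indicator measurableSet_Iio)

lemma integrable_exp_mul_of_bounded {ν : Measure ℝ} [IsFiniteMeasure ν] (s : ℝ) {g : ℝ → ℝ}
    (hg : Measurable g) {C : ℝ} (hC : ∀ y, |g y| ≤ C) :
    Integrable (fun y : ℝ => Complex.exp (s * y * Complex.I) * (g y : ℂ)) ν := by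
  refine Integrable.of_bound (C := C) ?_ (ae_of_all _ fun y => ?_)
  · exact Measurable.aestronglyMeasurable (by fun_prop)
  · rw [norm_mul, norm_exp_mul_mul_I, one_mul, Complex.norm_real]
    exact hC y

lemma norm_signCharFun_le (ν : Measure ℝ) [IsProbabilityMeasure ν] (s : ℝ) :
    ‖signCharFun ν s‖ ≤ 1 := by
  refine (norm_integral_le_of_norm_le_const (C := 1) (ae_of_all _ fun y => ?_)).trans_eq (by simp)
  rw [norm_mul, norm_exp_mul_mul_I, one_mul, Complex.norm_real]
  exact abs_sign_le_one y

lemma abs_mul_sinc_le {u : ℝ} (hu : 0 < u) (y : ℝ) : |y * Real.sinc (u * y)| ≤ u⁻¹ := by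
  rcases eq_or_ne y 0 with rfl | hy
  · simpa using hu.le
  · have huy : u * y ≠ 0 := mul_ne_zero hu.ne' hy
    rw [Real.sinc_of_ne_zero huy, abs_mul, abs_div, abs_mul, abs_of_pos hu]
    have := Real.abs_sin_le_one (u * y)
    have hy' := abs_pos.2 hy
    rw [mul_div_assoc', div_le_iff₀ (by positivity)]
    have : u⁻¹ * (u * |y|) = |y| := by field_simp
    rw [this]
    exact mul_le_of_le_one_right hy'.le ‹_›

/-- This is e^{i(s+u)y} - e^{i(s-u)y} = 2i e^{isy} sin(uy). The kernel sin(uy)/u is written as y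
sinc(uy), which is continuous in both variables. -/
lemma charFun_add_sub_charFun_sub (ν : Measure ℝ) [IsFiniteMeasure ν] (s : ℝ) {u : ℝ}
    (hu : u ≠ 0) :
    1 / (u : ℂ) * (charFun ν (s + u) - charFun ν (s - u)) =
      2 * Complex.I * ∫ y, Complex.exp (s * y * Complex.I) *
        ((y * Real.sinc (u * y) : ℝ) : ℂ) ∂ν := by
  have hint : ∀ t : ℝ, Integrable (fun y : ℝ => Complex.exp (t * y * Complex.I)) ν := by
    intro t
    simpa using integrable_exp_mul_of_bounded (ν := ν) t (g := fun _ => 1) measurable_const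
      (C := 1) (by simp)
  rw [charFun_apply_real, charFun_apply_real, ← integral_sub (hint _) (hint _),
    ← integral_const_mul, ← integral_const_mul]
  refine integral_congr_ae (ae_of_all _ fun y => ?_)
  simp only
  have hu' : (u : ℂ) ≠ 0 := by exact_mod_cast hu
  have h1 : ((y * Real.sinc (u * y) : ℝ) : ℂ) = Complex.sin (u * y) / u := by
    rcases eq_or_ne y 0 with rfl | hy
    · simp
    · rw [Real.sinc_of_ne_zero (mul_ne_zero hu hy)]
      have hy' : (y : ℂ) ≠ 0 := by exact_mod_cast hy
      push_cast
      field_simp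
  have h2 : Complex.exp (((s + u : ℝ) : ℂ) * y * Complex.I) =
      Complex.exp (s * y * Complex.I) * Complex.exp (u * y * Complex.I) := by
    rw [← Complex.exp_add]; push_cast; ring_nf
  have h3 : Complex.exp (((s - u : ℝ) : ℂ) * y * Complex.I) =
      Complex.exp (s * y * Complex.I) * Complex.exp (-(u * y) * Complex.I) := by
    rw [← Complex.exp_add]; push_cast; ring_nf
  rw [h1, h2, h3, Complex.sin]
  field_simp
  rw [Complex.I_sq]
  ring

lemma integral_charFun_add_sub_charFun_sub (ν : Measure ℝ) [IsProbabilityMeasure ν] (s : ℝ)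
    {ε A : ℝ} (hε : 0 < ε) (hεA : ε ≤ A) :
    ∫ u in ε..A, 1 / (u : ℂ) * (charFun ν (s + u) - charFun ν (s - u)) =
      2 * Complex.I * ∫ y, Complex.exp (s * y * Complex.I) *
        ((sineIntegral (A * y) - sineIntegral (ε * y) : ℝ) : ℂ) ∂ν := by
  have h1 : ∫ u in ε..A, 1 / (u : ℂ) * (charFun ν (s + u) - charFun ν (s - u)) =
      ∫ u in Set.Ioc ε A, 2 * Complex.I * ∫ y, Complex.exp (s * y * Complex.I) *
        ((y * Real.sinc (u * y) : ℝ) : ℂ) ∂ν := by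
    rw [intervalIntegral.integral_of_le hεA]
    exact setIntegral_congr_fun measurableSet_Ioc fun u hu =>
      charFun_add_sub_charFun_sub ν s (hε.trans hu.1).ne'
  have hint : Integrable (Function.uncurry fun u y : ℝ => Complex.exp (s * y * Complex.I) *
      ((y * Real.sinc (u * y) : ℝ) : ℂ)) ((volume.restrict (Set.Ioc ε A)).prod ν) := by
    -- Cutting at ε makes the kernel bounded, so Fubini needs no moment assumption on ν.
    refine Integrable.of_bound (C := ε⁻¹) ?_ ?_
    · refine Continuous.aestronglyMeasurable ?_
      unfold Function.uncurry
      have : Continuous fun p : ℝ × ℝ => Real.sinc (p.1 * p.2) :=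
        Real.continuous_sinc.comp (by fun_prop)
      fun_prop
    · have : ∀ᵐ p ∂(volume.restrict (Set.Ioc ε A)).prod ν, p.1 ∈ Set.Ioc ε A :=
        Measure.quasiMeasurePreserving_fst.ae (ae_restrict_mem measurableSet_Ioc)
      filter_upwards [this] with p hp
      rw [Function.uncurry, norm_mul, norm_exp_mul_mul_I, one_mul, Complex.norm_real]
      exact (abs_mul_sinc_le (hε.trans hp.1) p.2).trans
        (inv_anti₀ hε hp.1.le)
  rw [h1, integral_const_mul, integral_integral_swap hint]
  congr 1
  refine integral_congr_ae (ae_of_all _ fun y => ?_)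
  simp only
  rw [integral_const_mul, ← intervalIntegral.integral_of_le hεA, intervalIntegral.integral_ofReal,
    integral_mul_sinc]

lemma norm_integral_exp_mul_sineIntegral_le (ν : Measure ℝ) [IsProbabilityMeasure ν] (s a b : ℝ) :
    ‖∫ y, Complex.exp (s * y * Complex.I) *
      ((sineIntegral (a * y) - sineIntegral (b * y) : ℝ) : ℂ) ∂ν‖ ≤ 8 := by
  refine (norm_integral_le_of_norm_le_const (C := 8) (ae_of_all _ fun y => ?_)).trans_eq (by simp)
  rw [norm_mul, norm_exp_mul_mul_I, one_mul, Complex.norm_real]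
  refine (abs_sub _ _).trans ?_
  linarith [abs_sineIntegral_le (a * y), abs_sineIntegral_le (b * y)]

lemma tendsto_integral_exp_mul_sineIntegral (ν : Measure ℝ) [IsProbabilityMeasure ν] (s : ℝ) :
    Tendsto (fun p : ℝ × ℝ => ∫ y, Complex.exp (s * y * Complex.I) *
      ((sineIntegral (p.2 * y) - sineIntegral (p.1 * y) : ℝ) : ℂ) ∂ν)
      (𝓝[>] (0 : ℝ) ×ˢ atTop) (𝓝 (Real.pi / 2 * signCharFun ν s)) := by
  rw [signCharFun, ← integral_const_mul]
  refine tendsto_integral_filter_of_dominated_convergence (fun _ => 8) ?_ ?_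
    (integrable_const _) (ae_of_all _ fun y => ?_)
  · refine Eventually.of_forall fun p => Continuous.aestronglyMeasurable ?_
    have h : ∀ a : ℝ, Continuous fun y : ℝ => sineIntegral (a * y) := fun a =>
      continuous_sineIntegral.comp (by fun_prop)
    have h1 := h p.1
    have h2 := h p.2
    fun_prop
  · refine Eventually.of_forall fun p => ae_of_all _ fun y => ?_
    rw [norm_mul, norm_exp_mul_mul_I, one_mul, Complex.norm_real]
    refine (abs_sub _ _).trans ?_
    linarith [abs_sineIntegral_le (p.2 * y), abs_sineIntegral_le (p.1 * y)]
  · have := ((Complex.continuous_ofReal.tendsto _).comp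
      (tendsto_sineIntegral_mul_sub y)).const_mul (Complex.exp (s * y * Complex.I))
    refine this.trans_eq ?_
    push_cast
    ring_nf

lemma HasPVIntegral.sub {g h : ℝ → ℂ} {L M : ℂ} (hg : HasPVIntegral g L)
    (hh : HasPVIntegral h M) : HasPVIntegral (fun u => g u - h u) (L - M) := by
  refine ⟨fun ε A hε hA => ⟨(hg.1 ε A hε hA).1.sub (hh.1 ε A hε hA).1,
    (hg.1 ε A hε hA).2.sub (hh.1 ε A hε hA).2⟩, (hg.2.sub hh.2).congr' ?_⟩
  have h1 : ∀ᶠ p : ℝ × ℝ in 𝓝[>] (0 : ℝ) ×ˢ atTop, 0 < p.1 ∧ p.1 ≤ p.2 := by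
    filter_upwards [prod_mem_prod (Ioo_mem_nhdsGT (zero_lt_one (α := ℝ)))
      (eventually_ge_atTop (1 : ℝ))] with p hp using ⟨hp.1.1, hp.1.2.le.trans hp.2⟩
  filter_upwards [h1] with p hp
  rw [intervalIntegral.integral_sub (hg.1 _ _ hp.1 hp.2).1 (hh.1 _ _ hp.1 hp.2).1,
    intervalIntegral.integral_sub (hg.1 _ _ hp.1 hp.2).2 (hh.1 _ _ hp.1 hp.2).2]
  ring

/-! ### Principal logarithms and the principal-value integral -/

lemma re_one_sub_pos {w : ℂ} (hw : ‖w‖ < 1) : 0 < (1 - w).re := by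
  have := (Complex.re_le_norm w).trans_lt hw
  simpa using this

/-- Both arguments lie in (-π/2, π/2), so their sum does not leave the principal branch. -/
lemma log_mul_of_re_pos {a b : ℂ} (ha : 0 < a.re) (hb : 0 < b.re) :
    Complex.log (a * b) = Complex.log a + Complex.log b := by
  have h1 := abs_lt.1 (Complex.abs_arg_lt_pi_div_two_iff.2 (Or.inl ha))
  have h2 := abs_lt.1 (Complex.abs_arg_lt_pi_div_two_iff.2 (Or.inl hb))
  refine Complex.log_mul (by rintro rfl; simp at ha) (by rintro rfl; simp at hb) ⟨?_, ?_⟩ <;>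
    linarith [h1.1, h1.2, h2.1, h2.2]

lemma log_div_of_re_pos {a b : ℂ} (ha : 0 < a.re) (hb : 0 < b.re) :
    Complex.log (a / b) = Complex.log a - Complex.log b := by
  have hb0 : b ≠ 0 := by rintro rfl; simp at hb
  have hbi : 0 < (b⁻¹).re := by
    rw [Complex.inv_re]
    exact div_pos hb (Complex.normSq_pos.2 hb0)
  have harg : b.arg ≠ Real.pi := fun h => by
    have := abs_lt.1 (Complex.abs_arg_lt_pi_div_two_iff.2 (Or.inl hb))
    linarith [this.2, Real.pi_pos]
  rw [div_eq_mul_inv, log_mul_of_re_pos ha hbi, Complex.log_inv _ harg, sub_eq_add_neg]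

/-- At n = 0 the quotient is 0, by the convention for division by zero; series with these weights
therefore start at n = 1. -/
lemma norm_pow_div_natCast_le (z : ℂ) (n : ℕ) : ‖z ^ n / (n : ℂ)‖ ≤ ‖z‖ ^ n := by
  rw [norm_div, norm_pow, Complex.norm_natCast]
  rcases Nat.eq_zero_or_pos n with rfl | hn
  · simp
  · exact div_le_self (by positivity) (by exact_mod_cast hn)

lemma summable_pow_div_mul {z : ℂ} (hz : ‖z‖ < 1) {c : ℕ → ℂ} {C : ℝ} (hc : ∀ n, ‖c n‖ ≤ C) :
    Summable fun n : ℕ => z ^ n / (n : ℂ) * c n := by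
  refine Summable.of_norm_bounded ((summable_geometric_of_lt_one (norm_nonneg z) hz).mul_right C)
    fun n => ?_
  rw [norm_mul]
  exact mul_le_mul (norm_pow_div_natCast_le z n) (hc n) (norm_nonneg _) (by positivity)

/-- The principal-value integral of the logarithm of a quotient of resolvents of a characteristic
function `f`, in terms of measures with characteristic functions `f ^ n`. -/
lemma hasPVIntegral_log_div {f : ℝ → ℂ} {z : ℂ} (hz : ‖z‖ < 1) (ν : ℕ → Measure ℝ)
    [∀ n, IsProbabilityMeasure (ν n)] (hν : ∀ n u, charFun (ν n) u = f u ^ n) (s : ℝ) :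
    HasPVIntegral
      (fun u : ℝ => 1 / (u : ℂ) * Complex.log ((1 - z * f (s - u)) / (1 - z * f (s + u))))
      (2 * Real.pi * Complex.I * ∑' n : ℕ, z ^ n / (n : ℂ) * signCharFun (ν n) s) := by
  have hf1 : f = charFun (ν 1) := by ext u; simp [hν]
  have hfc : Continuous f := hf1 ▸ continuous_charFun
  have hfn : ∀ u, ‖z * f u‖ < 1 := fun u => by
    rw [norm_mul, hf1]
    exact (mul_le_of_le_one_right (norm_nonneg z) (norm_charFun_le_one u)).trans_lt hz
  have hre : ∀ u, 0 < (1 - z * f u).re := fun u => re_one_sub_pos (hfn u)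
  set J : ℝ → ℂ := fun u : ℝ =>
    1 / (u : ℂ) * Complex.log ((1 - z * f (s - u)) / (1 - z * f (s + u))) with hJ
  have hJ' : ∀ u, J u = 1 / (u : ℂ) *
      (Complex.log (1 - z * f (s - u)) - Complex.log (1 - z * f (s + u))) := fun u => by
    rw [hJ]; simp only; rw [log_div_of_re_pos (hre _) (hre _)]
  -- Evenness makes the integrals over the two half-lines equal, so only [ε, A] has to be treated.
  have heven : ∀ u, J (-u) = J u := fun u => by
    rw [hJ', hJ', sub_neg_eq_add, ← sub_eq_add_neg]
    push_cast
    ring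
  have hlogc : Continuous fun u => Complex.log (1 - z * f u) :=
    Continuous.clog (by fun_prop) fun u => Or.inl (hre u)
  have hcont : ContinuousOn J {0}ᶜ := by
    have : J = fun u : ℝ => 1 / (u : ℂ) *
      (Complex.log (1 - z * f (s - u)) - Complex.log (1 - z * f (s + u))) := funext hJ'
    rw [this]
    have h1 : Continuous fun u : ℝ => Complex.log (1 - z * f (s - u)) :=
      hlogc.comp (continuous_const.sub continuous_id)
    have h2 : Continuous fun u : ℝ => Complex.log (1 - z * f (s + u)) :=
      hlogc.comp (continuous_const.add continuous_id)
    refine ContinuousOn.mul (ContinuousOn.div continuousOn_const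
      Complex.continuous_ofReal.continuousOn fun u hu => ?_) (h1.sub h2).continuousOn
    exact_mod_cast hu
  have hii : ∀ ε A : ℝ, 0 < ε → ε ≤ A →
      IntervalIntegrable J volume ε A ∧ IntervalIntegrable J volume (-A) (-ε) := by
    intro ε A hε hA
    constructor
    · refine (hcont.mono ?_).intervalIntegrable
      rw [Set.uIcc_of_le hA]
      exact fun x hx => (hε.trans_le hx.1).ne'
    · refine (hcont.mono ?_).intervalIntegrable
      rw [Set.uIcc_of_le (neg_le_neg hA)]
      exact fun x hx => (hx.2.trans_lt (neg_neg_of_pos hε)).ne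
  set K : ℝ × ℝ → ℕ → ℂ := fun p n => ∫ y, Complex.exp (s * y * Complex.I) *
      ((sineIntegral (p.2 * y) - sineIntegral (p.1 * y) : ℝ) : ℂ) ∂(ν n) with hK
  have hseries : ∀ u : ℝ, HasSum (fun n : ℕ => z ^ n / (n : ℂ) *
      (1 / (u : ℂ) * (charFun (ν n) (s + u) - charFun (ν n) (s - u)))) (J u) := by
    intro u
    rw [hJ']
    have h1 := Complex.hasSum_taylorSeries_neg_log (hfn (s + u))
    have h2 := Complex.hasSum_taylorSeries_neg_log (hfn (s - u))
    have h3 := (h1.sub h2).mul_left (1 / (u : ℂ))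
    have h4 : 1 / (u : ℂ) * (-Complex.log (1 - z * f (s + u)) - -Complex.log (1 - z * f (s - u))) =
        1 / (u : ℂ) * (Complex.log (1 - z * f (s - u)) - Complex.log (1 - z * f (s + u))) := by
      ring
    rw [h4] at h3
    convert! h3 using 2 with n
    rw [hν, hν, mul_pow, mul_pow]
    ring
  have hhalf : ∀ ε A : ℝ, 0 < ε → ε ≤ A →
      HasSum (fun n : ℕ => z ^ n / (n : ℂ) * (2 * Complex.I * K (ε, A) n)) (∫ u in ε..A, J u) := by
    intro ε A hε hA
    -- The logarithmic series may be integrated term by term: on [ε, A] its terms are at most ‖z‖^n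
    -- · 2/ε.
    have h := intervalIntegral.hasSum_integral_of_dominated_convergence (μ := volume)
      (a := ε) (b := A) (f := J)
      (F := fun (n : ℕ) (u : ℝ) => z ^ n / (n : ℂ) *
        (1 / (u : ℂ) * (charFun (ν n) (s + u) - charFun (ν n) (s - u))))
      (fun n _ => ‖z‖ ^ n * (ε⁻¹ * 2)) (fun n => ?_) (fun n => ae_of_all _ fun u hu => ?_)
      (ae_of_all _ fun u _ => ?_) (by simp) (ae_of_all _ fun u _ => hseries u)
    · convert! h using 2 with n
      rw [intervalIntegral.integral_const_mul, integral_charFun_add_sub_charFun_sub _ _ hε hA]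
    · have hc : Measurable (charFun (ν n)) := measurable_charFun
      exact Measurable.aestronglyMeasurable (by fun_prop)
    · rw [Set.uIoc_of_le hA] at hu
      rw [norm_mul, norm_mul]
      refine mul_le_mul (norm_pow_div_natCast_le z n) (mul_le_mul ?_ ?_ (norm_nonneg _)
        (by positivity)) (by positivity) (by positivity)
      · rw [norm_div, norm_one, Complex.norm_real, Real.norm_eq_abs,
          abs_of_pos (hε.trans hu.1), one_div]
        exact inv_anti₀ hε hu.1.le
      · refine (norm_sub_le _ _).trans ?_
        linarith [norm_charFun_le_one (μ := ν n) (s + u), norm_charFun_le_one (μ := ν n) (s - u)]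
    · exact (summable_geometric_of_lt_one (norm_nonneg z) hz).mul_right _
  refine ⟨hii, ?_⟩
  have hev : ∀ᶠ p : ℝ × ℝ in 𝓝[>] (0 : ℝ) ×ˢ atTop, 0 < p.1 ∧ p.1 ≤ p.2 := by
    filter_upwards [prod_mem_prod (Ioo_mem_nhdsGT (zero_lt_one (α := ℝ)))
      (eventually_ge_atTop (1 : ℝ))] with p hp using ⟨hp.1.1, hp.1.2.le.trans hp.2⟩
  have hlim : Tendsto (fun p : ℝ × ℝ => ∑' n : ℕ, z ^ n / (n : ℂ) * (2 * Complex.I * K p n))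
      (𝓝[>] (0 : ℝ) ×ˢ atTop)
      (𝓝 (∑' n : ℕ, z ^ n / (n : ℂ) *
        (2 * Complex.I * (Real.pi / 2 * signCharFun (ν n) s)))) := by
    -- The bound must not depend on ε and A: 16 is |2i| times the bound 8 for the sine-integral
    -- transform.
    refine tendsto_tsum_of_dominated_convergence (bound := fun n => ‖z‖ ^ n * 16)
      ((summable_geometric_of_lt_one (norm_nonneg z) hz).mul_right _) (fun n => ?_)
      (Eventually.of_forall fun p n => ?_)
    · exact ((tendsto_integral_exp_mul_sineIntegral (ν n) s).const_mul _).const_mul _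
    · rw [norm_mul]
      refine mul_le_mul (norm_pow_div_natCast_le z n) ?_ (norm_nonneg _) (by positivity)
      rw [norm_mul, norm_mul, Complex.norm_I]
      have := norm_integral_exp_mul_sineIntegral_le (ν n) s p.2 p.1
      norm_num
      linarith
  have hL : 2 * Real.pi * Complex.I * ∑' n : ℕ, z ^ n / (n : ℂ) * signCharFun (ν n) s =
      2 * ∑' n : ℕ, z ^ n / (n : ℂ) * (2 * Complex.I * (Real.pi / 2 * signCharFun (ν n) s)) := by
    rw [← tsum_mul_left, ← tsum_mul_left]
    congr 1 with n
    ring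
  rw [hL]
  refine (hlim.const_mul 2).congr' ?_
  filter_upwards [hev] with p hp
  have hneg : ∫ u in (-p.2)..(-p.1), J u = ∫ u in p.1..p.2, J u := by
    rw [← intervalIntegral.integral_comp_neg]
    simp only [heven]
  rw [hneg, (hhalf p.1 p.2 hp.1 hp.2).tsum_eq]
  ring

/-! ### Formal Wiener-Hopf factorization -/

section Algebra

variable {R : Type*} [CommRing R]

/-- Comparing coefficients in A' = A U gives U_n = (n+1) A_{n+1} - Σ_{k<n} A_{k+1} U_{n-k-1}. The
constant coefficient 1 of A is split off because V is not assumed to contain 1. -/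
lemma coeff_derivative_mul_inv_mem {A U : PowerSeries R} {V : AddSubgroup R}
    (hV : ∀ x ∈ V, ∀ y ∈ V, x * y ∈ V) (hA0 : PowerSeries.coeff 0 A = 1)
    (hA : ∀ n, PowerSeries.coeff (n + 1) A ∈ V)
    (hU : PowerSeries.derivative R A = A * U) (n : ℕ) : PowerSeries.coeff n U ∈ V := by
  induction n using Nat.strong_induction_on with
  | _ n ih =>
    have h := congrArg (PowerSeries.coeff n) hU
    rw [PowerSeries.coeff_derivative, PowerSeries.coeff_mul,
      Finset.Nat.sum_antidiagonal_eq_sum_range_succ_mk, Finset.sum_range_succ'] at h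
    simp only [hA0, one_mul, Nat.sub_zero] at h
    have h1 : PowerSeries.coeff n U = (n + 1) • PowerSeries.coeff (n + 1) A -
        ∑ k ∈ Finset.range n,
          PowerSeries.coeff (k + 1) A * PowerSeries.coeff (n - (k + 1)) U := by
      rw [nsmul_eq_mul, eq_sub_iff_add_eq, add_comm, ← h]
      push_cast
      ring
    rw [h1]
    refine V.sub_mem (V.nsmul_mem (hA n) _) (V.sum_mem fun k hk => hV _ (hA k) _ (ih _ ?_))
    have := Finset.mem_range.1 hk
    omega

/-- Uniqueness of the Wiener-Hopf factorization of `1 / (1 - μ X)`, in the form of a formula for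
the logarithmic derivatives of the factors. -/
theorem derivative_eq_of_mul_eq_geometric {A B p q : PowerSeries R} {μ : R} {V W : AddSubgroup R}
    (hV : ∀ x ∈ V, ∀ y ∈ V, x * y ∈ V) (hW : ∀ x ∈ W, ∀ y ∈ W, x * y ∈ W)
    (hVW : ∀ x ∈ V, x ∈ W → x = 0)
    (hA0 : PowerSeries.coeff 0 A = 1) (hA : ∀ n, PowerSeries.coeff (n + 1) A ∈ V)
    (hB0 : PowerSeries.coeff 0 B = 1) (hB : ∀ n, PowerSeries.coeff (n + 1) B ∈ W)
    (hAB : A * B = PowerSeries.mk fun n => μ ^ n)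
    (hp : ∀ n, PowerSeries.coeff n p ∈ V) (hq : ∀ n, PowerSeries.coeff n q ∈ W)
    (hpq : p + q = PowerSeries.mk fun n => μ ^ (n + 1)) :
    PowerSeries.derivative R A = A * p ∧ PowerSeries.derivative R B = B * q := by
  have hinvA : A * PowerSeries.invOfUnit A 1 = 1 := 
    PowerSeries.mul_invOfUnit A 1 (by simpa using hA0)
  have hinvB : B * PowerSeries.invOfUnit B 1 = 1 := 
    PowerSeries.mul_invOfUnit B 1 (by simpa using hB0)
  set U := PowerSeries.invOfUnit A 1 * PowerSeries.derivative R A with hUdef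
  set T := PowerSeries.invOfUnit B 1 * PowerSeries.derivative R B with hTdef
  have hU : PowerSeries.derivative R A = A * U := by
    rw [hUdef, ← mul_assoc, hinvA, one_mul]
  have hT : PowerSeries.derivative R B = B * T := by
    rw [hTdef, ← mul_assoc, hinvB, one_mul]
  -- For G = Σ μ^n X^n one has G' = G · Σ μ^(n+1) X^n: both sides have n-th coefficient (n+1)
  -- μ^(n+1).
  have hder : PowerSeries.derivative R (A * B) = A * B * (p + q) := by
    rw [hAB, hpq]
    ext n
    rw [PowerSeries.coeff_derivative, PowerSeries.coeff_mul, PowerSeries.coeff_mk]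
    simp only [PowerSeries.coeff_mk]
    rw [Finset.sum_congr rfl (g := fun _ => μ ^ (n + 1)) fun x hx => ?_]
    · simp [mul_comm]
    · rw [← pow_add, ← add_assoc, Finset.HasAntidiagonal.mem_antidiagonal.1 hx]
  have hsum : U + T = p + q := by
    have h1 : A * B * (U + T) = A * B * (p + q) := by
      rw [← hder, Derivation.leibniz, hU, hT, smul_eq_mul, smul_eq_mul]
      ring
    have h2 := congrArg (fun x => PowerSeries.invOfUnit A 1 * PowerSeries.invOfUnit B 1 * x) h1
    have h3 : ∀ x, PowerSeries.invOfUnit A 1 * PowerSeries.invOfUnit B 1 * (A * B * x) = x := by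
      intro x
      calc _ = (A * PowerSeries.invOfUnit A 1) * (B * PowerSeries.invOfUnit B 1) * x := by ring
        _ = x := by rw [hinvA, hinvB, one_mul, one_mul]
    simpa only [h3] using h2
  have hUp : U = p := by
    ext n
    have hc := congrArg (PowerSeries.coeff n) hsum
    rw [map_add, map_add] at hc
    -- U - p has its coefficients in V, while q - T, to which it is equal, has them in W.
    refine sub_eq_zero.1 (hVW _ (V.sub_mem (coeff_derivative_mul_inv_mem hV hA0 hA hU n) (hp n)) ?_)
    have : PowerSeries.coeff n U - PowerSeries.coeff n p =
        PowerSeries.coeff n q - PowerSeries.coeff n T := by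
      linear_combination hc
    rw [this]
    exact W.sub_mem (hq n) (coeff_derivative_mul_inv_mem hW hB0 hB hT n)
  have hTq : T = q := by
    rw [hUp] at hsum
    exact add_left_cancel hsum
  exact ⟨by rw [hU, hUp], by rw [hT, hTq]⟩

end Algebra

/-! ### Transforms of signed measures carried by a half-line -/

lemma charFun_add_measure (μ ν : Measure ℝ) [IsFiniteMeasure μ] [IsFiniteMeasure ν] :
    charFun (μ + ν) = charFun μ + charFun ν := by
  have hint : ∀ (ρ : Measure ℝ) [IsFiniteMeasure ρ] (t : ℝ),
      Integrable (fun y : ℝ => Complex.exp (t * y * Complex.I)) ρ := by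
    intro ρ _ t
    simpa using integrable_exp_mul_of_bounded (ν := ρ) t (g := fun _ => 1) measurable_const
      (C := 1) (by simp)
  ext t
  rw [Pi.add_apply, charFun_apply_real, charFun_apply_real, charFun_apply_real,
    integral_add_measure (hint _ _) (hint _ _)]

/-- The Fourier transforms of the finite signed measures concentrated on `D`. -/
def fourierSubgroup (D : Set ℝ) : AddSubgroup (ℝ → ℂ) where
  carrier := {g | ∃ μ ν : Measure ℝ, IsFiniteMeasure μ ∧ IsFiniteMeasure ν ∧ μ Dᶜ = 0 ∧ ν Dᶜ = 0 ∧
    g = charFun μ - charFun ν}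
  zero_mem' := ⟨0, 0, inferInstance, inferInstance, by simp, by simp, by simp⟩
  add_mem' := by
    rintro _ _ ⟨μ, ν, hμ, hν, hμD, hνD, rfl⟩ ⟨μ', ν', hμ', hν', hμD', hνD', rfl⟩
    refine ⟨μ + μ', ν + ν', inferInstance, inferInstance, by simp [hμD, hμD'],
      by simp [hνD, hνD'], ?_⟩
    rw [charFun_add_measure, charFun_add_measure]
    abel
  neg_mem' := by
    rintro _ ⟨μ, ν, hμ, hν, hμD, hνD, rfl⟩
    exact ⟨ν, μ, hν, hμ, hνD, hμD, by abel⟩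

lemma charFun_mem_fourierSubgroup {D : Set ℝ} {μ : Measure ℝ} [IsFiniteMeasure μ]
    (hμ : μ Dᶜ = 0) : charFun μ ∈ fourierSubgroup D :=
  ⟨μ, 0, inferInstance, inferInstance, hμ, by simp, by ext; simp⟩

lemma conv_compl_eq_zero {D : Set ℝ} (hD : MeasurableSet D)
    (hadd : ∀ x ∈ D, ∀ y ∈ D, x + y ∈ D) {μ ν : Measure ℝ} [IsFiniteMeasure μ] [IsFiniteMeasure ν]
    (hμ : μ Dᶜ = 0) (hν : ν Dᶜ = 0) : (μ ∗ ν) Dᶜ = 0 := by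
  rw [Measure.conv, Measure.map_apply (by fun_prop) hD.compl]
  have h1 : ∀ᵐ p ∂μ.prod ν, p.1 ∈ D :=
    Measure.quasiMeasurePreserving_fst.ae (p := fun x => x ∈ D) hμ
  have h2 : ∀ᵐ p ∂μ.prod ν, p.2 ∈ D :=
    Measure.quasiMeasurePreserving_snd.ae (p := fun x => x ∈ D) hν
  have h3 : ∀ᵐ p ∂μ.prod ν, p.1 + p.2 ∈ D := by
    filter_upwards [h1, h2] with p hp1 hp2 using hadd _ hp1 _ hp2
  exact h3

/-- Products of transforms are transforms of convolutions, and a set closed under addition carries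
the convolution of measures it carries. -/
lemma mul_mem_fourierSubgroup {D : Set ℝ} (hD : MeasurableSet D)
    (hadd : ∀ x ∈ D, ∀ y ∈ D, x + y ∈ D) :
    ∀ g ∈ fourierSubgroup D, ∀ h ∈ fourierSubgroup D, g * h ∈ fourierSubgroup D := by
  rintro _ ⟨μ, ν, hμ, hν, hμD, hνD, rfl⟩ _ ⟨μ', ν', hμ', hν', hμD', hνD', rfl⟩
  refine ⟨μ ∗ μ' + ν ∗ ν', μ ∗ ν' + ν ∗ μ', inferInstance, inferInstance, ?_, ?_, ?_⟩
  · simp [conv_compl_eq_zero hD hadd hμD hμD', conv_compl_eq_zero hD hadd hνD hνD']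
  · simp [conv_compl_eq_zero hD hadd hμD hνD', conv_compl_eq_zero hD hadd hνD hμD']
  · rw [charFun_add_measure, charFun_add_measure]
    ext t
    simp only [Pi.mul_apply, Pi.sub_apply, Pi.add_apply, charFun_conv]
    ring

/-- Uniqueness of characteristic functions turns equality of the two representations into μ + ν' = ν
+ μ'. Restricting to D removes μ' and ν', leaving μ = ν. -/
lemma eq_zero_of_mem_fourierSubgroup {D E : Set ℝ} (hDE : Disjoint D E)
    {g : ℝ → ℂ} (hgD : g ∈ fourierSubgroup D) (hgE : g ∈ fourierSubgroup E) : g = 0 := by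
  obtain ⟨μ, ν, hμ, hν, hμD, hνD, rfl⟩ := hgD
  obtain ⟨μ', ν', hμ', hν', hμE, hνE, h⟩ := hgE
  have h1 : μ + ν' = ν + μ' := by
    refine Measure.ext_of_charFun ?_
    rw [charFun_add_measure, charFun_add_measure, add_comm (charFun ν)]
    exact sub_eq_sub_iff_add_eq_add.1 h
  have hz : ∀ ρ : Measure ℝ, ρ Eᶜ = 0 → ρ.restrict D = 0 := fun ρ hρ =>
    Measure.restrict_eq_zero.2 (measure_mono_null hDE.subset_compl_right hρ)
  have hr : ∀ ρ : Measure ℝ, ρ Dᶜ = 0 → ρ.restrict D = ρ := fun ρ hρ =>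
    Measure.restrict_eq_self_of_ae_mem hρ
  have h2 := congrArg (fun ρ => ρ.restrict D) h1
  simp only [Measure.restrict_add, hz _ hμE, hz _ hνE, hr _ hμD, hr _ hνD, add_zero] at h2
  rw [h2, sub_self]

/-! ### Splitting a path at its first maximum -/

/-- The partial sums of a sequence. -/
def seqSum (x : ℕ → ℝ) (n : ℕ) : ℝ := ∑ j ∈ Finset.range n, x j

/-- The sequences whose `k`-th partial sum exceeds all the previous ones. -/
def ladderSet (k : ℕ) : Set (ℕ → ℝ) := {x | ∀ j < k, seqSum x j < seqSum x k}

/-- The sequences with nonpositive partial sums up to time `m`. -/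
def nonposSet (m : ℕ) : Set (ℕ → ℝ) := {x | ∀ j ≤ m, seqSum x j ≤ 0}

@[fun_prop]
lemma measurable_seqSum (n : ℕ) : Measurable fun x : ℕ → ℝ => seqSum x n := by
  unfold seqSum
  fun_prop

lemma measurableSet_ladderSet (k : ℕ) : MeasurableSet (ladderSet k) := by
  simp only [ladderSet, Set.ofPred_forall]
  exact MeasurableSet.iInter fun j => MeasurableSet.iInter fun _ =>
    measurableSet_lt (measurable_seqSum j) (measurable_seqSum k)

lemma measurableSet_nonposSet (m : ℕ) : MeasurableSet (nonposSet m) := by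
  simp only [nonposSet, Set.ofPred_forall]
  exact MeasurableSet.iInter fun j => MeasurableSet.iInter fun _ =>
    measurableSet_le (measurable_seqSum j) measurable_const

lemma seqSum_shift (x : ℕ → ℝ) (k j : ℕ) :
    seqSum (fun i => x (k + i)) j = seqSum x (k + j) - seqSum x k := by
  rw [seqSum, seqSum, seqSum, Finset.sum_range_add, add_sub_cancel_left]

lemma seqSum_truncate (x : ℕ → ℝ) {j k : ℕ} (hjk : j ≤ k) :
    seqSum (fun i => if i < k then x i else 0) j = seqSum x j := by
  refine Finset.sum_congr rfl fun i hi => if_pos ?_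
  exact (Finset.mem_range.1 hi).trans_le hjk

/-- The ladder event depends on the first k steps only, which is what the independence argument
needs. -/
lemma truncate_mem_ladderSet (x : ℕ → ℝ) (k : ℕ) :
    (fun i => if i < k then x i else 0) ∈ ladderSet k ↔ x ∈ ladderSet k := by
  simp only [ladderSet, Set.mem_ofPred_eq]
  refine forall₂_congr fun j hj => ?_
  rw [seqSum_truncate x hj.le, seqSum_truncate x le_rfl]

/-- Membership in the two sets identifies `k` as the first time at which the maximum of the
partial sums up to time `n` is attained. -/
lemma ladder_nonpos_iff {x : ℕ → ℝ} {k n : ℕ} (hk : k ≤ n) :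
    (x ∈ ladderSet k ∧ (fun i => x (k + i)) ∈ nonposSet (n - k)) ↔
      (∀ j < k, seqSum x j < seqSum x k) ∧ ∀ j ≤ n, seqSum x j ≤ seqSum x k := by
  simp only [ladderSet, nonposSet, Set.mem_ofPred_eq, seqSum_shift, sub_nonpos]
  refine and_congr_right fun h => ⟨fun h2 j hj => ?_, fun h2 j hj => h2 _ (by omega)⟩
  rcases lt_or_ge j k with hjk | hjk
  · exact (h j hjk).le
  · have := h2 (j - k) (by omega)
    rwa [Nat.add_sub_cancel' hjk] at this

/-- The transform of the ladder part of the walk, as a function of the steps. -/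
def ladderFun (k : ℕ) (s : ℝ) : (ℕ → ℝ) → ℂ :=
  (ladderSet k).indicator fun x => Complex.exp (s * (seqSum x k : ℝ) * Complex.I)

/-- The transform of the nonpositive part of the walk, as a function of the steps. -/
def nonposFun (m : ℕ) (s : ℝ) : (ℕ → ℝ) → ℂ :=
  (nonposSet m).indicator fun x => Complex.exp (s * (seqSum x m : ℝ) * Complex.I)

lemma measurable_ladderFun (k : ℕ) (s : ℝ) : Measurable (ladderFun k s) :=
  Measurable.indicator (by fun_prop) (measurableSet_ladderSet k)

lemma measurable_nonposFun (m : ℕ) (s : ℝ) : Measurable (nonposFun m s) :=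
  Measurable.indicator (by fun_prop) (measurableSet_nonposSet m)

lemma norm_ladderFun_le (k : ℕ) (s : ℝ) (x : ℕ → ℝ) : ‖ladderFun k s x‖ ≤ 1 :=
  (norm_indicator_le_norm_self _ _).trans (norm_exp_mul_mul_I _ _).le

lemma norm_nonposFun_le (m : ℕ) (s : ℝ) (x : ℕ → ℝ) : ‖nonposFun m s x‖ ≤ 1 :=
  (norm_indicator_le_norm_self _ _).trans (norm_exp_mul_mul_I _ _).le

/-- Only the first index k attaining the maximum contributes, and there the exponent splits as s S_k
- t (S_n - S_k). -/
lemma exp_max_eq_sum {x : ℕ → ℝ} {n : ℕ} {M : ℝ} (hM : ∀ j ≤ n, seqSum x j ≤ M)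
    (hMx : ∃ k ≤ n, M = seqSum x k) (s t : ℝ) :
    Complex.exp (Complex.I * ((s * M + t * (M - seqSum x n) : ℝ) : ℂ)) =
      ∑ k ∈ Finset.range (n + 1), ladderFun k s x *
        nonposFun (n - k) (-t) (fun i => x (k + i)) := by
  classical
  obtain ⟨hk, hMk⟩ := Nat.find_spec hMx
  have hmin := fun j => Nat.find_min hMx (m := j)
  set k := Nat.find hMx with hkdef
  have hlt : ∀ j < k, seqSum x j < seqSum x k := fun j hj =>
    lt_of_le_of_ne (hMk ▸ hM j (by omega)) fun h => hmin j hj ⟨by omega, by rw [hMk, h]⟩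
  have hle : ∀ j ≤ n, seqSum x j ≤ seqSum x k := fun j hj => hMk ▸ hM j hj
  obtain ⟨h1, h2⟩ := (ladder_nonpos_iff hk).2 ⟨hlt, hle⟩
  rw [Finset.sum_eq_single k]
  · rw [ladderFun, nonposFun, Set.indicator_of_mem h1, Set.indicator_of_mem h2, ← Complex.exp_add,
      seqSum_shift, Nat.add_sub_cancel' hk, hMk]
    push_cast
    ring_nf
  · intro j hj hjk
    have hjn : j ≤ n := by have := Finset.mem_range.1 hj; omega
    by_contra hne
    have h3 : x ∈ ladderSet j := Set.mem_of_indicator_ne_zero (left_ne_zero_of_mul hne)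
    have h4 : (fun i => x (j + i)) ∈ nonposSet (n - j) :=
      Set.mem_of_indicator_ne_zero (right_ne_zero_of_mul hne)
    obtain ⟨h5, h6⟩ := (ladder_nonpos_iff hjn).1 ⟨h3, h4⟩
    rcases lt_or_gt_of_ne hjk with h | h
    · exact absurd (hlt j h) (not_lt.2 (h6 k hk))
    · exact absurd (h5 k h) (not_lt.2 (hle j hjn))
  · intro h
    exact absurd (Finset.mem_range.2 (Nat.lt_succ_of_le hk)) h

/-! ### Factorization and recurrence for the random walk -/

section Walk

variable {Ω : Type*} [MeasurableSpace Ω] {P : Measure Ω} {X : ℕ → Ω → ℝ}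

/-- Exhibits the ladder and nonpositive transforms as characteristic functions of finite measures,
so that only the supports remain to be checked. -/
lemma integral_indicator_exp_eq_charFun (hmeas : ∀ j, Measurable (X j)) {E : Set (ℕ → ℝ)}
    (hE : MeasurableSet E) (n : ℕ) (s : ℝ) :
    ∫ ω, E.indicator (fun x => Complex.exp (s * (seqSum x n : ℝ) * Complex.I))
      (fun i => X i ω) ∂P =
      charFun (((P.map fun ω i => X i ω).restrict E).map fun x => seqSum x n) s := by
  have hm0 : Measurable fun ω (i : ℕ) => X i ω := measurable_pi_iff.2 fun i => hmeas _
  rw [charFun_apply_real, integral_map (by fun_prop) (by fun_prop), ← integral_indicator hE,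
    integral_map hm0.aemeasurable]
  exact (Measurable.indicator (by fun_prop) hE).aestronglyMeasurable

lemma measurable_walkSum (hmeas : ∀ j, Measurable (X j)) (n : ℕ) : Measurable (walkSum X n) :=
  Finset.measurable_fun_sum _ fun j _ => hmeas j

/-- The steps before k and those from k on generate independent σ-algebras. Padding the past with
zeros keeps it in the sequence space, so path functionals apply to it unchanged. -/
lemma indepFun_truncate_shift (hmeas : ∀ j, Measurable (X j)) (hindep : iIndepFun X P) (k : ℕ) :
    IndepFun (fun ω i => if i < k then X i ω else 0) (fun ω i => X (k + i) ω) P := by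
  have hI := indep_iSup_of_disjoint (fun n => (hmeas n).comap_le) hindep.iIndep
    (S := Set.Iio k) (T := Set.Ici k)
    (Set.disjoint_left.2 fun a ha hb => not_lt.2 (Set.mem_Ici.1 hb) (Set.mem_Iio.1 ha))
  refine (IndepFun_iff_Indep _ _ _).2
    (indep_of_indep_of_le_left (indep_of_indep_of_le_right hI ?_) ?_)
  · rw [MeasurableSpace.pi, MeasurableSpace.comap_iSup]
    refine iSup_le fun i => ?_
    rw [MeasurableSpace.comap_comp]
    exact le_iSup₂_of_le (k + i) (Nat.le_add_right k i) le_rfl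
  · rw [MeasurableSpace.pi, MeasurableSpace.comap_iSup]
    refine iSup_le fun i => ?_
    rw [MeasurableSpace.comap_comp]
    by_cases h : i < k
    · have he : (fun x : ℕ → ℝ => x i) ∘ (fun ω i => if i < k then X i ω else 0) = X i := by
        ext ω
        simp [h]
      rw [he]
      exact le_iSup₂_of_le i h le_rfl
    · have he : (fun x : ℕ → ℝ => x i) ∘ (fun ω i => if i < k then X i ω else 0) =
          fun _ => 0 := by
        ext ω
        simp [h]
      rw [he, MeasurableSpace.comap_const]
      exact bot_le

/-- The Markov property at time `k` of a sequence of i.i.d. random variables. -/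
lemma integral_mul_shift (hmeas : ∀ j, Measurable (X j)) (hindep : iIndepFun X P)
    (hident : ∀ j, IdentDistrib (X j) (X 0) P P) {k : ℕ} {G H : (ℕ → ℝ) → ℂ}
    (hG : Measurable G) (hH : Measurable H)
    (hGk : ∀ x : ℕ → ℝ, G (fun i => if i < k then x i else 0) = G x) :
    ∫ ω, G (fun i => X i ω) * H (fun i => X (k + i) ω) ∂P =
      (∫ ω, G (fun i => X i ω) ∂P) * ∫ ω, H (fun i => X i ω) ∂P := by
  have h1 := (indepFun_truncate_shift hmeas hindep k).comp hG hH
  have hm1 : Measurable fun ω (i : ℕ) => if i < k then X i ω else 0 := by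
    refine measurable_pi_iff.2 fun i => ?_
    split_ifs
    · exact hmeas i
    · exact measurable_const
  have hm2 : Measurable fun ω (i : ℕ) => X (k + i) ω := measurable_pi_iff.2 fun i => hmeas _
  have h2 := h1.integral_fun_mul_eq_mul_integral (hG.comp hm1).aestronglyMeasurable
    (hH.comp hm2).aestronglyMeasurable
  simp only [Function.comp_apply] at h2
  have hGk' : ∀ ω, G (fun i => if i < k then X i ω else 0) = G (fun i => X i ω) := fun ω =>
    hGk fun i => X i ω
  simp only [hGk'] at h2
  rw [h2]
  congr 1
  -- The shifted sequence is again i.i.d. with the same marginals, hence has the law of the whole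
  -- sequence.
  have hid : IdentDistrib (fun ω i => X (k + i) ω) (fun ω i => X i ω) P P :=
    IdentDistrib.pi (fun i => (hident (k + i)).trans (hident i).symm)
      (hindep.precomp (g := fun i => k + i) (add_right_injective k)) hindep
  exact (hid.comp hH).integral_eq

variable [IsProbabilityMeasure P]

lemma jointCF_eq_sum (hmeas : ∀ j, Measurable (X j)) (hindep : iIndepFun X P)
    (hident : ∀ j, IdentDistrib (X j) (X 0) P P) (n : ℕ) (s t : ℝ) :
    jointCF P X n s t = ∑ k ∈ Finset.range (n + 1), (∫ ω, ladderFun k s (fun i => X i ω) ∂P) *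
      ∫ ω, nonposFun (n - k) (-t) (fun i => X i ω) ∂P := by
  have hm : ∀ k : ℕ, Measurable fun ω (i : ℕ) => X (k + i) ω := fun k =>
    measurable_pi_iff.2 fun i => hmeas _
  have hm0 : Measurable fun ω (i : ℕ) => X i ω := measurable_pi_iff.2 fun i => hmeas _
  have h1 : jointCF P X n s t = ∫ ω, ∑ k ∈ Finset.range (n + 1), ladderFun k s (fun i => X i ω) *
      nonposFun (n - k) (-t) (fun i => X (k + i) ω) ∂P := by
    refine integral_congr_ae (ae_of_all _ fun ω => ?_)
    refine exp_max_eq_sum (x := fun i => X i ω) (M := walkMax X n ω) (fun j hj => ?_) ?_ s t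
    · exact Finset.le_sup' (fun k => walkSum X k ω) (Finset.mem_range.2 (Nat.lt_succ_of_le hj))
    · obtain ⟨k, hk, hk'⟩ := Finset.exists_mem_eq_sup' Finset.nonempty_range_add_one
        (s := Finset.range (n + 1)) (fun k => walkSum X k ω)
      exact ⟨k, Nat.lt_succ_iff.1 (Finset.mem_range.1 hk), hk'⟩
  rw [h1, integral_finsetSum]
  · refine Finset.sum_congr rfl fun k _ => ?_
    refine integral_mul_shift hmeas hindep hident (measurable_ladderFun k s)
      (measurable_nonposFun _ _) fun x => ?_
    by_cases hx : x ∈ ladderSet k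
    · rw [ladderFun, Set.indicator_of_mem hx,
        Set.indicator_of_mem ((truncate_mem_ladderSet x k).2 hx), seqSum_truncate x le_rfl]
    · rw [ladderFun, Set.indicator_of_notMem hx,
        Set.indicator_of_notMem (mt (truncate_mem_ladderSet x k).1 hx)]
  · intro k _
    refine Integrable.of_bound (C := 1) (Measurable.aestronglyMeasurable ?_)
      (ae_of_all _ fun ω => ?_)
    · exact ((measurable_ladderFun k s).comp hm0).mul ((measurable_nonposFun _ _).comp (hm k))
    · rw [norm_mul]
      exact mul_le_one₀ (norm_ladderFun_le _ _ _) (norm_nonneg _) (norm_nonposFun_le _ _ _)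

lemma integral_ladderFun_zero (s : ℝ) : ∫ ω, ladderFun 0 s (fun i => X i ω) ∂P = 1 := by
  simp [ladderFun, ladderSet, seqSum]

lemma integral_nonposFun_zero (s : ℝ) : ∫ ω, nonposFun 0 s (fun i => X i ω) ∂P = 1 := by
  simp [nonposFun, nonposSet, seqSum]

lemma integral_ladderFun_mem (hmeas : ∀ j, Measurable (X j)) (k : ℕ) :
    (fun s => ∫ ω, ladderFun (k + 1) s (fun i => X i ω) ∂P) ∈ fourierSubgroup (Set.Ioi 0) := by
  have hm0 : Measurable fun ω (i : ℕ) => X i ω := measurable_pi_iff.2 fun i => hmeas _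
  have hE := measurableSet_ladderSet (k + 1)
  have : (fun s => ∫ ω, ladderFun (k + 1) s (fun i => X i ω) ∂P) = _ :=
    funext fun s => integral_indicator_exp_eq_charFun hmeas hE (k + 1) s
  rw [this]
  refine charFun_mem_fourierSubgroup ?_
  rw [Measure.map_apply (by fun_prop) measurableSet_Ioi.compl, Measure.restrict_apply
    (measurable_seqSum _ measurableSet_Ioi.compl)]
  convert measure_empty (μ := P.map fun ω i => X i ω)
  ext x
  simp only [Set.mem_inter_iff, Set.mem_preimage, Set.mem_compl_iff, Set.mem_Ioi,
    Set.mem_empty_iff_false, iff_false, not_and]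
  intro h1 h2
  -- A record at time k + 1 exceeds in particular S_0 = 0.
  have := h2 0 (Nat.succ_pos k)
  simp only [seqSum, Finset.range_zero, Finset.sum_empty] at this
  exact h1 this

lemma integral_nonposFun_mem (hmeas : ∀ j, Measurable (X j)) (m : ℕ) :
    (fun s => ∫ ω, nonposFun m s (fun i => X i ω) ∂P) ∈ fourierSubgroup (Set.Iic 0) := by
  have hE := measurableSet_nonposSet m
  have : (fun s => ∫ ω, nonposFun m s (fun i => X i ω) ∂P) = _ :=
    funext fun s => integral_indicator_exp_eq_charFun hmeas hE m s
  have hm0 : Measurable fun ω (i : ℕ) => X i ω := measurable_pi_iff.2 fun i => hmeas _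
  rw [this]
  refine charFun_mem_fourierSubgroup ?_
  rw [Measure.map_apply (by fun_prop) measurableSet_Iic.compl, Measure.restrict_apply
    (measurable_seqSum _ measurableSet_Iic.compl)]
  convert measure_empty (μ := P.map fun ω i => X i ω)
  ext x
  simp only [Set.mem_inter_iff, Set.mem_preimage, Set.mem_compl_iff, Set.mem_Iic,
    Set.mem_empty_iff_false, iff_false, not_and]
  intro h1 h2
  exact h1 (h2 m le_rfl)

lemma charFun_map_walkSum (hmeas : ∀ j, Measurable (X j)) (hindep : iIndepFun X P)
    (hident : ∀ j, IdentDistrib (X j) (X 0) P P) (n : ℕ) (u : ℝ) :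
    charFun (P.map (walkSum X n)) u = charFun (P.map (X 0)) u ^ n := by
  induction n with
  | zero =>
    have : walkSum X 0 = fun _ => (0 : ℝ) := by ext; simp [walkSum]
    rw [this, Measure.map_const]
    simp [charFun_dirac]
  | succ n ih =>
    have hs : walkSum X (n + 1) = walkSum X n + X n := by
      ext ω
      simp [walkSum, Finset.sum_range_succ]
    have hi : IndepFun (walkSum X n) (X n) P := by
      have := hindep.indepFun_sum_range_succ hmeas n
      convert this using 1
      ext ω
      simp [walkSum]
    rw [hs, hi.charFun_map_add_eq_mul (measurable_walkSum hmeas n).aemeasurable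
      (hmeas n).aemeasurable, Pi.mul_apply, ih, (hident n).map_eq, pow_succ]

/-- The Spitzer-Pollaczek identity for the coefficients of the generating function. -/
theorem jointCF_recurrence (hmeas : ∀ j, Measurable (X j)) (hindep : iIndepFun X P)
    (hident : ∀ j, IdentDistrib (X j) (X 0) P P) (s t : ℝ) (n : ℕ) :
    ((n : ℂ) + 1) * jointCF P X (n + 1) s t = ∑ p ∈ Finset.HasAntidiagonal.antidiagonal n,
      jointCF P X p.1 s t *
        (charFun ((P.map (walkSum X (p.2 + 1))).restrict (Set.Ioi 0)) s +
          charFun ((P.map (walkSum X (p.2 + 1))).restrict (Set.Iic 0)) (-t)) := by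
  set A : PowerSeries (ℝ → ℂ) :=
    PowerSeries.mk fun k s => ∫ ω, ladderFun k s (fun i => X i ω) ∂P with hA
  set B : PowerSeries (ℝ → ℂ) :=
    PowerSeries.mk fun k s => ∫ ω, nonposFun k s (fun i => X i ω) ∂P with hB
  set p : PowerSeries (ℝ → ℂ) :=
    PowerSeries.mk fun k => charFun ((P.map (walkSum X (k + 1))).restrict (Set.Ioi 0)) with hp
  set q : PowerSeries (ℝ → ℂ) :=
    PowerSeries.mk fun k => charFun ((P.map (walkSum X (k + 1))).restrict (Set.Iic 0)) with hq
  have hprob : ∀ k, IsProbabilityMeasure (P.map (walkSum X k)) := fun k =>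
    Measure.isProbabilityMeasure_map (measurable_walkSum hmeas k).aemeasurable
  have hAB : A * B = PowerSeries.mk fun k => charFun (P.map (X 0)) ^ k := by
    ext k v
    rw [PowerSeries.coeff_mul, PowerSeries.coeff_mk,
      Finset.Nat.sum_antidiagonal_eq_sum_range_succ_mk, Finset.sum_apply, Pi.pow_apply,
      ← charFun_map_walkSum hmeas hindep hident]
    -- With t = -s the maximum cancels from the exponent and E e^{isS_k} remains.
    have h := jointCF_eq_sum hmeas hindep hident k v (-v)
    rw [neg_neg] at h
    simp only [hA, hB, PowerSeries.coeff_mk, Pi.mul_apply]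
    rw [← h, jointCF, charFun_apply_real, integral_map (measurable_walkSum hmeas k).aemeasurable
      (by fun_prop)]
    refine integral_congr_ae (ae_of_all _ fun ω => ?_)
    simp only
    congr 1
    push_cast
    ring
  have hpq : p + q = PowerSeries.mk fun k => charFun (P.map (X 0)) ^ (k + 1) := by
    ext k v
    rw [map_add, PowerSeries.coeff_mk, PowerSeries.coeff_mk, PowerSeries.coeff_mk, Pi.pow_apply,
      ← charFun_map_walkSum hmeas hindep hident, ← charFun_add_measure, ← Set.compl_Ioi,
      Measure.restrict_add_restrict_compl measurableSet_Ioi]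
  obtain ⟨hA', hB'⟩ := derivative_eq_of_mul_eq_geometric
    (V := fourierSubgroup (Set.Ioi 0)) (W := fourierSubgroup (Set.Iic 0)) (A := A) (B := B)
    (p := p) (q := q)
    (mul_mem_fourierSubgroup measurableSet_Ioi fun x hx y hy =>
      Set.mem_Ioi.2 (add_pos (Set.mem_Ioi.1 hx) (Set.mem_Ioi.1 hy)))
    (mul_mem_fourierSubgroup measurableSet_Iic fun x hx y hy =>
      add_nonpos (Set.mem_Iic.1 hx) (Set.mem_Iic.1 hy))
    (fun g => eq_zero_of_mem_fourierSubgroup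
      (Set.disjoint_left.2 fun a ha hb => not_lt.2 (Set.mem_Iic.1 hb) (Set.mem_Ioi.1 ha)))
    (by ext v; rw [hA, PowerSeries.coeff_mk]; exact integral_ladderFun_zero v)
    (fun k => by rw [hA, PowerSeries.coeff_mk]; exact integral_ladderFun_mem hmeas k)
    (by ext v; rw [hB, PowerSeries.coeff_mk]; exact integral_nonposFun_zero v)
    (fun k => by rw [hB, PowerSeries.coeff_mk]; exact integral_nonposFun_mem hmeas (k + 1))
    hAB
    (fun k => by
      rw [hp, PowerSeries.coeff_mk]
      refine charFun_mem_fourierSubgroup ?_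
      rw [Measure.restrict_apply measurableSet_Ioi.compl, Set.compl_inter_self, measure_empty])
    (fun k => by
      rw [hq, PowerSeries.coeff_mk]
      refine charFun_mem_fourierSubgroup ?_
      rw [Measure.restrict_apply measurableSet_Iic.compl, Set.compl_inter_self, measure_empty])
    hpq
  -- Evaluation at a frequency commutes with d/dz, so the equations for A and B may be used at the
  -- different points s and -t.
  set ev : ℝ → PowerSeries (ℝ → ℂ) →+* PowerSeries ℂ := fun v =>
    PowerSeries.map (Pi.evalRingHom (fun _ : ℝ => ℂ) v) with hev
  have hevd : ∀ v (C D : PowerSeries (ℝ → ℂ)), PowerSeries.derivative _ C = C * D →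
      PowerSeries.derivative ℂ (ev v C) = ev v C * ev v D := by
    intro v C D h
    rw [← map_mul, ← h]
    ext k
    simp [hev, PowerSeries.coeff_derivative]
  have hF : ev s A * ev (-t) B = PowerSeries.mk fun k => jointCF P X k s t := by
    ext k
    rw [PowerSeries.coeff_mul, PowerSeries.coeff_mk,
      Finset.Nat.sum_antidiagonal_eq_sum_range_succ_mk, jointCF_eq_sum hmeas hindep hident]
    simp [hev, hA, hB]
  have hF' : PowerSeries.derivative ℂ (ev s A * ev (-t) B) =
      ev s A * ev (-t) B * (ev s p + ev (-t) q) := by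
    rw [Derivation.leibniz, hevd s A p hA', hevd (-t) B q hB', smul_eq_mul, smul_eq_mul]
    ring
  rw [hF] at hF'
  have h := congrArg (PowerSeries.coeff n) hF'
  rw [PowerSeries.coeff_derivative, PowerSeries.coeff_mul, PowerSeries.coeff_mk] at h
  rw [mul_comm, h]
  refine Finset.sum_congr rfl fun x _ => ?_
  simp [hev, hp, hq]

end Walk

/-! ### From the recurrence to the exponential -/

/-- A power series whose coefficients satisfy the recurrence of the exponential of another power
series is that exponential. -/
theorem hasSum_exp_of_recurrence {φ c : ℕ → ℂ} {C : ℝ} (h0 : φ 0 = 1) (hφ : ∀ n, ‖φ n‖ ≤ 1)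
    (hc : ∀ n, ‖c n‖ ≤ C)
    (hrec : ∀ n : ℕ, ((n : ℂ) + 1) * φ (n + 1) =
      ∑ p ∈ Finset.HasAntidiagonal.antidiagonal n, φ p.1 * c (p.2 + 1))
    {z : ℂ} (hz : ‖z‖ < 1) :
    HasSum (fun n => φ n * z ^ n) (Complex.exp (∑' n : ℕ, z ^ n / (n : ℂ) * c n)) := by
  obtain ⟨r, hzr, hr1⟩ := exists_between hz
  have hr0 : 0 ≤ r := (norm_nonneg z).trans hzr.le
  have hgeo : Summable fun n : ℕ => r ^ n := summable_geometric_of_lt_one hr0 hr1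
  have hC : 0 ≤ C := (norm_nonneg _).trans (hc 0)
  set U : Set ℂ := Metric.ball 0 r with hU
  have hUo : IsOpen U := Metric.isOpen_ball
  have hUn : ∀ w ∈ U, ‖w‖ < r := fun w hw => by simpa [hU] using hw
  have hpow : ∀ w ∈ U, ∀ n : ℕ, ‖w‖ ^ n ≤ r ^ n := fun w hw n =>
    pow_le_pow_left₀ (norm_nonneg w) (hUn w hw).le n
  set F : ℂ → ℂ := fun w => ∑' n : ℕ, φ n * w ^ n with hF
  set E : ℂ → ℂ := fun w => ∑' n : ℕ, w ^ n / (n : ℂ) * c n with hE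
  have hFd : ∀ n : ℕ, DifferentiableOn ℂ (fun w : ℂ => φ n * w ^ n) U := fun n => by fun_prop
  have hEd : ∀ n : ℕ, DifferentiableOn ℂ (fun w : ℂ => w ^ n / (n : ℂ) * c n) U := fun n => by
    fun_prop
  have hFb : ∀ (n : ℕ) (w : ℂ), w ∈ U → ‖φ n * w ^ n‖ ≤ r ^ n := fun n w hw => by
    rw [norm_mul, norm_pow]
    exact (mul_le_of_le_one_left (by positivity) (hφ n)).trans (hpow w hw n)
  have hEb : ∀ (n : ℕ) (w : ℂ), w ∈ U → ‖w ^ n / (n : ℂ) * c n‖ ≤ r ^ n * C := fun n w hw => by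
    rw [norm_mul]
    exact mul_le_mul ((norm_pow_div_natCast_le w n).trans (hpow w hw n)) (hc n) (norm_nonneg _)
      (by positivity)
  have hFdiff := Complex.differentiableOn_tsum_of_summable_norm hgeo hFd hUo hFb
  have hEdiff := Complex.differentiableOn_tsum_of_summable_norm (hgeo.mul_right C) hEd hUo hEb
  have hF' : ∀ w ∈ U, HasSum (fun n : ℕ => ((n : ℂ) + 1) * φ (n + 1) * w ^ n) (deriv F w) := by
    intro w hw
    have h := Complex.hasSum_deriv_of_summable_norm hgeo hFd hUo hFb hw
    -- The n = 0 term is constant in w; dropping it shifts the index to the form used in the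
    -- recurrence.
    rw [← hasSum_nat_add_iff' 1] at h
    simp only [Finset.range_one, Finset.sum_singleton, pow_zero, deriv_const, sub_zero] at h
    convert! h using 2 with n
    simp
    ring
  have hE' : ∀ w ∈ U, HasSum (fun n : ℕ => c (n + 1) * w ^ n) (deriv E w) := by
    intro w hw
    have h := Complex.hasSum_deriv_of_summable_norm (hgeo.mul_right C) hEd hUo hEb hw
    rw [← hasSum_nat_add_iff' 1] at h
    simp only [Finset.range_one, Finset.sum_singleton, pow_zero, deriv_const, sub_zero] at h
    convert! h using 2 with n
    have hn : (n : ℂ) + 1 ≠ 0 := by exact_mod_cast n.succ_ne_zero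
    simp
    field_simp
  -- The recurrence says that the coefficients of F' are those of the Cauchy product F E', so F
  -- e^{-E} is constant on the disc.
  have hODE : ∀ w ∈ U, deriv F w = F w * deriv E w := by
    intro w hw
    have hsF : Summable fun n : ℕ => ‖φ n * w ^ n‖ :=
      Summable.of_nonneg_of_le (fun _ => norm_nonneg _) (fun n => hFb n w hw) hgeo
    have hsE : Summable fun n : ℕ => ‖c (n + 1) * w ^ n‖ := by
      refine Summable.of_nonneg_of_le (fun _ => norm_nonneg _) (fun n => ?_) (hgeo.mul_left C)
      rw [norm_mul, norm_pow]
      exact mul_le_mul (hc _) (hpow w hw n) (by positivity) hC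
    rw [← (hE' w hw).tsum_eq, ← (hF' w hw).tsum_eq, hF]
    simp only
    rw [tsum_mul_tsum_eq_tsum_sum_antidiagonal_of_summable_norm hsF hsE]
    refine tsum_congr fun n => ?_
    rw [hrec, Finset.sum_mul]
    refine Finset.sum_congr rfl fun p hp => ?_
    rw [← Finset.HasAntidiagonal.mem_antidiagonal.1 hp, pow_add]
    ring
  have hFat : ∀ w ∈ U, DifferentiableAt ℂ F w := fun w hw =>
    hFdiff.differentiableAt (hUo.mem_nhds hw)
  have hEat : ∀ w ∈ U, DifferentiableAt ℂ E w := fun w hw =>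
    hEdiff.differentiableAt (hUo.mem_nhds hw)
  have hg : ∀ w ∈ U, HasDerivAt (fun w => F w * Complex.exp (-E w)) 0 w := by
    intro w hw
    have h := (hFat w hw).hasDerivAt.mul ((hEat w hw).hasDerivAt.neg.cexp)
    refine h.congr_deriv ?_
    rw [hODE w hw, Pi.neg_apply]
    ring
  have h0U : (0 : ℂ) ∈ U := by
    rw [hU, Metric.mem_ball, dist_self]
    exact (norm_nonneg z).trans_lt hzr
  have hzU : z ∈ U := by simpa [hU] using hzr
  have hconst : F z * Complex.exp (-E z) = F 0 * Complex.exp (-E 0) :=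
    hUo.is_const_of_deriv_eq_zero (convex_ball 0 r).isPreconnected
      (fun w hw => (hg w hw).differentiableAt.differentiableWithinAt)
      (fun w hw => (hg w hw).deriv) hzU h0U
  have hE0 : E 0 = 0 := by
    rw [hE]
    refine (tsum_congr fun n => ?_).trans tsum_zero
    rcases Nat.eq_zero_or_pos n with rfl | hn
    · simp
    · simp [hn.ne']
  have hF0 : F 0 = 1 := by
    rw [hF]
    simp only
    rw [tsum_eq_single 0 fun n hn => by simp [hn]]
    simp [h0]
  rw [hE0, hF0, neg_zero, Complex.exp_zero, mul_one, Complex.exp_neg] at hconst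
  have hFz : F z = Complex.exp (E z) := by
    rwa [mul_inv_eq_one₀ (Complex.exp_ne_zero _)] at hconst
  have hsum : Summable fun n : ℕ => φ n * z ^ n :=
    Summable.of_norm_bounded hgeo fun n => hFb n z hzU
  exact hFz ▸ hsum.hasSum

/-! ### Assembly of the identity -/

/-- Off 0 the indicators are (1 ± sgn y) / 2. At y = 0 the left side gives 1 from the closed
half-line and the right side 1/2 + 1/2, so an atom at 0 does no harm. -/
lemma charFun_restrict_add_charFun_restrict (ν : Measure ℝ) [IsProbabilityMeasure ν] (s t : ℝ) :
    charFun (ν.restrict (Set.Ioi 0)) s + charFun (ν.restrict (Set.Iic 0)) t =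
      1 / 2 * (charFun ν s + charFun ν t) + 1 / 2 * (signCharFun ν s - signCharFun ν t) := by
  have hint : ∀ v : ℝ, Integrable (fun y : ℝ => Complex.exp (v * y * Complex.I)) ν := by
    intro v
    simpa using integrable_exp_mul_of_bounded (ν := ν) v (g := fun _ => 1) measurable_const
      (C := 1) (by simp)
  have hsgn : ∀ v : ℝ, Integrable
      (fun y : ℝ => Complex.exp (v * y * Complex.I) * ((SignType.sign y : ℝ) : ℂ)) ν := fun v =>
    integrable_exp_mul_of_bounded v measurable_sign_real abs_sign_le_one
  have hsub : Integrable (fun y : ℝ => Complex.exp (s * y * Complex.I) *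
      ((SignType.sign y : ℝ) : ℂ) - Complex.exp (t * y * Complex.I) *
        ((SignType.sign y : ℝ) : ℂ)) ν := (hsgn s).sub (hsgn t)
  simp only [charFun_apply_real, signCharFun]
  rw [← integral_indicator measurableSet_Ioi, ← integral_indicator measurableSet_Iic,
    ← integral_add ((hint s).indicator measurableSet_Ioi) ((hint t).indicator measurableSet_Iic),
    ← integral_add (hint s) (hint t), ← integral_sub (hsgn s) (hsgn t), ← integral_const_mul,
    ← integral_const_mul, ← integral_add (((hint s).fun_add (hint t)).const_mul _)
      (hsub.const_mul _)]
  refine integral_congr_ae (ae_of_all _ fun y => ?_)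
  simp only
  rcases lt_trichotomy y 0 with h | rfl | h
  · rw [Set.indicator_of_notMem (by simpa using h.le), Set.indicator_of_mem (by simpa using h.le),
      sign_neg h]
    push_cast [SignType.coe_neg]
    simp
    ring
  · simp
    norm_num
  · rw [Set.indicator_of_mem (by simpa using h), Set.indicator_of_notMem (by simpa using h),
      sign_pos h]
    simp
    ring

lemma norm_jointCF_le {Ω : Type*} [MeasurableSpace Ω] (P : Measure Ω) [IsProbabilityMeasure P]
    (X : ℕ → Ω → ℝ) (n : ℕ) (s t : ℝ) : ‖jointCF P X n s t‖ ≤ 1 := by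
  refine (norm_integral_le_of_norm_le_const (C := 1) (ae_of_all _ fun ω => ?_)).trans_eq (by simp)
  rw [mul_comm, Complex.norm_exp_ofReal_mul_I]

lemma jointCF_zero {Ω : Type*} [MeasurableSpace Ω] (P : Measure Ω) [IsProbabilityMeasure P]
    (X : ℕ → Ω → ℝ) (s t : ℝ) : jointCF P X 0 s t = 1 := by
  simp [jointCF, walkMax, walkSum]

/-- The generating function of the joint transforms of `M_n` and `M_n - S_n`. -/
theorem hasSum_jointCF {Ω : Type*} [MeasurableSpace Ω] (P : Measure Ω) [IsProbabilityMeasure P]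
    (X : ℕ → Ω → ℝ) (hmeas : ∀ j, Measurable (X j)) (hindep : iIndepFun X P)
    (hident : ∀ j, IdentDistrib (X j) (X 0) P P)
    (f : ℝ → ℂ) (hf : f = charFun (P.map (X 0)))
    (s t : ℝ) (z : ℂ) (hz : ‖z‖ < 1) :
    ∃ L : ℂ,
      HasPVIntegral
        (fun u : ℝ => (1 / (u : ℂ)) *
          (Complex.log ((1 - z * f (s - u)) / (1 - z * f (s + u)))
            + Complex.log ((1 - z * f (-t + u)) / (1 - z * f (-t - u))))) L ∧
      HasSum (fun n : ℕ => jointCF P X n s t * z ^ n)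
        (1 / ((1 - z * f s) * (1 - z * f (-t))) ^ (1 / 2 : ℂ)
          * Complex.exp (1 / (4 * (Real.pi : ℂ) * Complex.I) * L)) := by
  set ν : ℕ → Measure ℝ := fun n => P.map (walkSum X n) with hνdef
  have hprob : ∀ n, IsProbabilityMeasure (ν n) := fun n =>
    Measure.isProbabilityMeasure_map (measurable_walkSum hmeas n).aemeasurable
  have hν : ∀ n u, charFun (ν n) u = f u ^ n := fun n u => by
    rw [hf]
    exact charFun_map_walkSum hmeas hindep hident n u
  have hP0 : IsProbabilityMeasure (P.map (X 0)) :=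
    Measure.isProbabilityMeasure_map (hmeas 0).aemeasurable
  have hfn : ∀ u, ‖z * f u‖ < 1 := fun u => by
    rw [norm_mul, hf]
    exact (mul_le_of_le_one_right (norm_nonneg z) (norm_charFun_le_one u)).trans_lt hz
  have hre : ∀ u, 0 < (1 - z * f u).re := fun u => re_one_sub_pos (hfn u)
  have hne : ∀ u, 1 - z * f u ≠ 0 := fun u h => by
    have := hre u
    rw [h] at this
    simp at this
  set T : ℝ → ℂ := fun v => ∑' n : ℕ, z ^ n / (n : ℂ) * signCharFun (ν n) v with hT
  -- The logarithm at -t has numerator and denominator interchanged, hence the minus sign. The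
  -- factor 1/(4πi) leaves (T(s) - T(-t)) / 2, the sign half of Spitzer's exponent.
  refine ⟨2 * Real.pi * Complex.I * T s - 2 * Real.pi * Complex.I * T (-t), ?_, ?_⟩
  · convert! (hasPVIntegral_log_div hz ν hν s).sub (hasPVIntegral_log_div hz ν hν (-t)) using 2
      with u
    rw [log_div_of_re_pos (hre _) (hre _), log_div_of_re_pos (hre _) (hre _),
      log_div_of_re_pos (hre _) (hre _)]
    ring
  · set c : ℕ → ℂ := fun n => charFun ((ν n).restrict (Set.Ioi 0)) s +
      charFun ((ν n).restrict (Set.Iic 0)) (-t) with hc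
    have hcn : ∀ n, ‖c n‖ ≤ 2 := fun n => by
      have h1 : ∀ (D : Set ℝ) (v : ℝ), ‖charFun ((ν n).restrict D) v‖ ≤ 1 := fun D v =>
        (norm_charFun_le v).trans (by simp)
      refine (norm_add_le _ _).trans ?_
      linarith [h1 (Set.Ioi 0) s, h1 (Set.Iic 0) (-t)]
    have hmain := hasSum_exp_of_recurrence (φ := fun n => jointCF P X n s t) (c := c)
      (jointCF_zero P X s t) (fun n => norm_jointCF_le P X n s t) hcn
      (jointCF_recurrence hmeas hindep hident s t) hz
    convert! hmain using 1
    have hlog : ∀ v, HasSum (fun n : ℕ => z ^ n / (n : ℂ) * charFun (ν n) v)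
        (-Complex.log (1 - z * f v)) := fun v => by
      convert! Complex.hasSum_taylorSeries_neg_log (hfn v) using 2 with n
      rw [hν, mul_pow]
      ring
    have hsgn : ∀ v, HasSum (fun n : ℕ => z ^ n / (n : ℂ) * signCharFun (ν n) v) (T v) := fun v =>
      (summable_pow_div_mul hz fun n => norm_signCharFun_le (ν n) v).hasSum
    have hsum : HasSum (fun n : ℕ => z ^ n / (n : ℂ) * c n)
        (1 / 2 * (-Complex.log (1 - z * f s) + -Complex.log (1 - z * f (-t))) +
          1 / 2 * (T s - T (-t))) := by
      convert! (((hlog s).add (hlog (-t))).mul_left (1 / 2)).add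
        (((hsgn s).sub (hsgn (-t))).mul_left (1 / 2)) using 2 with n
      rw [hc]
      simp only
      rw [charFun_restrict_add_charFun_restrict]
      ring
    -- The square root becomes exp of half a logarithm, which splits since both factors lie in the
    -- right half-plane.
    rw [hsum.tsum_eq, Complex.cpow_def_of_ne_zero (mul_ne_zero (hne _) (hne _)),
      log_mul_of_re_pos (hre _) (hre _), one_div, ← Complex.exp_neg, ← Complex.exp_add]
    congr 1
    have hpi : (Real.pi : ℂ) ≠ 0 := by exact_mod_cast Real.pi_ne_zero
    have hI := Complex.I_ne_zero
    field_simp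
    ring

end SpitzerIdentity
end

/-- Powers `w ^ (1 / 2 : ℂ)` and logarithms `Complex.log` are the principal ones;
`charFun (P.map (X 0)) v` is `E exp (i v X)` for a step `X` of the walk. -/
theorem corollary4 {Ω : Type*} [MeasurableSpace Ω] (P : Measure Ω) [IsProbabilityMeasure P]
    (X : ℕ → Ω → ℝ) (hmeas : ∀ j, Measurable (X j)) (hindep : iIndepFun X P)
    (hident : ∀ j, IdentDistrib (X j) (X 0) P P)
    (f : ℝ → ℂ) (hf : f = charFun (P.map (X 0)))
    (s t : ℝ) (z : ℂ) (hz : ‖z‖ < 1) :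
    (∃ L : ℂ,
      SpitzerIdentity.HasPVIntegral
        (fun u : ℝ => (1 / (u : ℂ)) *
          (Complex.log ((1 - z * f (s - u)) / (1 - z * f (s + u)))
            + Complex.log ((1 - z * f (-t + u)) / (1 - z * f (-t - u))))) L ∧
      HasSum (fun n : ℕ => SpitzerIdentity.jointCF P X n s t * z ^ n)
        (1 / ((1 - z * f s) * (1 - z * f (-t))) ^ (1 / 2 : ℂ)
          * Complex.exp (1 / (4 * (Real.pi : ℂ) * Complex.I) * L))) ∧
    (∃ L : ℂ,
      SpitzerIdentity.HasPVIntegral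
        (fun u : ℝ => (1 / (u : ℂ)) *
          (Complex.log ((1 - z * f (s - u)) / (1 - z * f (s + u)))
            + Complex.log ((1 - z * f u) / (1 - z * f (-u))))) L ∧
      HasSum
        (fun n : ℕ =>
          (∫ ω, Complex.exp (Complex.I * ((s * SpitzerIdentity.walkMax X n ω : ℝ) : ℂ)) ∂P)
            * z ^ n)
        (1 / ((1 - z * f s) * (1 - z)) ^ (1 / 2 : ℂ)
          * Complex.exp (1 / (4 * (Real.pi : ℂ) * Complex.I) * L))) := by
  refine ⟨SpitzerIdentity.hasSum_jointCF P X hmeas hindep hident f hf s t z hz, ?_⟩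
  have hP0 : IsProbabilityMeasure (P.map (X 0)) :=
    Measure.isProbabilityMeasure_map (hmeas 0).aemeasurable
  have hf0 : f 0 = 1 := by simp [hf]
  -- The case t = 0, where 1 - z f(-t) becomes 1 - z.
  simpa [SpitzerIdentity.jointCF, hf0] using
    SpitzerIdentity.hasSum_jointCF P X hmeas hindep hident f hf s 0 z hz
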